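/- Let $(R,\mathfrak m)$ be a one-dimensional Gorenstein local ring (that is, a Noetherian local ring of Krull dimension $1$ with finite injective dimension as a module over itself) that is reduced. Let $\overline R$ be the integral closure of $R$ in its total ring of fractions; assume that $\overline R$ is a finitely generated $R$-module, and let $C = R :_R \overline R = \{r \in R : r\overline R \subseteq R\}$ be the conductor. Let $Q = qR$ be a parameter ideal (here: an $\mathfrak m$-primary principal ideal) contained in $C$. Let $g(Q)$ denote the Goto number of $Q$, that is, the largest integer $i \ge 0$ such that every element of $Q : \mathfrak m^i$ is integral over the ideal $Q$. Then $g(Q)$ exists, the set of integers $i \ge 0$ with $C \subseteq \mathfrak m^i + Q$ has a largest element, and $$g(Q) = \max\{\, i \ge 0 : C \subseteq \mathfrak m^i + Q \,\}.$$ -/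

import Mathlib

universe u

namespace GotoNumber

open IsLocalRing

/-- A Noetherian local ring is Gorenstein if it has finite injective dimension as a module over
itself. (Noetherianity and locality are separate type class assumptions wherever this is used.) -/
def IsGorensteinLocal (R : Type u) [CommRing R] [IsNoetherianRing R] [IsLocalRing R] : Prop :=
  ∃ n : ℕ, CategoryTheory.HasInjectiveDimensionLE (ModuleCat.of R R) n

/-- A parameter ideal of a local ring `(R, m)` of dimension `d`: an `m`-primary ideal
(equivalently, an ideal whose radical is `m`) that is generated by `d` elements. -/
def IsParameterIdeal {R : Type u} [CommRing R] [IsLocalRing R] (Q : Ideal R) : Prop :=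
  Q.radical = maximalIdeal R ∧
    ∃ (d : ℕ) (a : Fin d → R), ringKrullDim R = (d : WithBot ℕ∞) ∧ Q = Ideal.span (Set.range a)

/-- `x` is integral over the ideal `J`: it satisfies an equation
`x ^ n + a₁ x ^ (n - 1) + ⋯ + aₙ = 0` with `n ≥ 1` and `aᵢ ∈ J ^ i` for all `i`. -/
def IsIntegralOverIdeal {R : Type u} [CommRing R] (J : Ideal R) (x : R) : Prop :=
  ∃ n : ℕ, 1 ≤ n ∧ ∃ a : ℕ → R, (∀ i ∈ Finset.Icc 1 n, a i ∈ J ^ i) ∧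
    x ^ n + ∑ i ∈ Finset.Icc 1 n, a i * x ^ (n - i) = 0

/-- The set of all `i` such that `Q : m ^ i` is integral over `Q`. -/
def integralColonExponents {R : Type u} [CommRing R] [IsLocalRing R] (Q : Ideal R) : Set ℕ :=
  {i : ℕ | ∀ x ∈ Submodule.colon Q ((maximalIdeal R ^ i : Ideal R) : Set R),
    IsIntegralOverIdeal Q x}

/-- The Goto number `g(Q)`: the largest `i` such that `Q : m ^ i` is integral over `Q`. -/
noncomputable def gotoNumber {R : Type u} [CommRing R] [IsLocalRing R] (Q : Ideal R) : ℕ :=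
  sSup (integralColonExponents Q)

/-- The integral closure of `R` in its total ring of fractions. -/
abbrev normalization (R : Type u) [CommRing R] : Subalgebra R (FractionRing R) :=
  integralClosure R (FractionRing R)

/-- The conductor `{r ∈ R | r R' ⊆ R}` of `R` in its integral closure `R'`; here `R` is regarded
as the submodule `1` of its total ring of fractions. -/
noncomputable def conductor (R : Type u) [CommRing R] : Ideal R :=
  Submodule.colon (1 : Submodule R (FractionRing R)) (normalization R : Set (FractionRing R))

end GotoNumber

/-! Write `Q = qR`, with `q` regular since `R` is reduced of dimension 1, and let `I` be the
integral closure of `Q`. As `Q ⊆ C`, every element of the normalization is `x / q` with `x ∈ I`, so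
`Q : I = C`. The Gorenstein hypothesis makes `J ↦ Q : J` an inclusion-reversing involution on ideals
`J ⊇ Q` (`colon_colon_eq`). Hence `I = Q : C`, and `Q : m ^ i = Q : (m ^ i + Q)` lies in `I` iff `C
⊆ m ^ i + Q`: the two sets of exponents coincide.

Duality is a case of self-injectivity of `R ⧸ Q`. Finite injective dimension forces `Ext^2(R ⧸ J, R)
= 0` for `m`-primary `J`, which lets maps into `R ⧸ Q` extend from cyclic submodules of `R ⧸ I`, for
any ideal `I ⊇ Q` (`exists_factorization_cyclic`). -/

namespace GotoNumber

open CategoryTheory Abelian IsLocalRing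

/-! ### Ext vanishing and extension of maps into `R ⧸ qR` -/

section Ext

variable {R : Type u} [CommRing R]

/-- The sequence `R ⧸ K ⟶ R ⧸ I ⟶ R ⧸ (I + xR)`, where the first map is multiplication by `x`
and `K = I : x`. -/
noncomputable abbrev cyclicShortComplex (I : Ideal R) (x : R) :
    ShortComplex (ModuleCat.{u} R) :=
  ModuleCat.shortComplexOfCompEqZero
    (Submodule.mapQ (Submodule.colon I {x}) I (LinearMap.mulRight R x)
      (fun r hr ↦ by simpa using hr))
    (Submodule.factor (le_sup_left : I ≤ I ⊔ Ideal.span {x})) (by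
      refine Submodule.linearMap_qext _ (LinearMap.ext_ring ?_)
      change Submodule.Quotient.mk (1 * x) = (0 : R ⧸ (I ⊔ Ideal.span {x}))
      rw [one_mul, Submodule.Quotient.mk_eq_zero]
      exact Submodule.mem_sup_right (Ideal.mem_span_singleton_self x))

lemma cyclicShortComplex_shortExact (I : Ideal R) (x : R) :
    (cyclicShortComplex I x).ShortExact := by
  refine ModuleCat.shortComplex_shortExact _ ?_ ?_ ?_
  · intro y
    obtain ⟨y, rfl⟩ := Submodule.mkQ_surjective _ y
    constructor
    · intro h
      have h : y ∈ I ⊔ Ideal.span {x} := (Submodule.Quotient.mk_eq_zero _).mp h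
      obtain ⟨a, ha, b, hb, rfl⟩ := Submodule.mem_sup.mp h
      obtain ⟨c, rfl⟩ := Ideal.mem_span_singleton'.mp hb
      refine ⟨Submodule.Quotient.mk c, (Submodule.Quotient.eq I).mpr ?_⟩
      change c * x - (a + c * x) ∈ I
      simpa using ha
    · rintro ⟨z, hz⟩
      obtain ⟨z, rfl⟩ := Submodule.mkQ_surjective _ z
      have h : z * x - y ∈ I := (Submodule.Quotient.eq I).mp hz
      have h2 : z * x - (z * x - y) ∈ I ⊔ Ideal.span {x} :=
        sub_mem (Submodule.mem_sup_right (Ideal.mul_mem_left _ z (Ideal.mem_span_singleton_self x)))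
          (Submodule.mem_sup_left h)
      exact (Submodule.Quotient.mk_eq_zero _).mpr (by simpa using h2)
  · refine (injective_iff_map_eq_zero _).mpr fun z hz ↦ ?_
    obtain ⟨z, rfl⟩ := Submodule.mkQ_surjective _ z
    have h : z * x ∈ I := (Submodule.Quotient.mk_eq_zero _).mp hz
    exact (Submodule.Quotient.mk_eq_zero _).mpr (Submodule.mem_colon_singleton.mpr h)
  · exact Submodule.factor_surjective le_sup_left

/-- The sequence `R ⟶ R ⟶ R ⧸ qR`, where the first map is multiplication by `q`. -/
noncomputable abbrev mulShortComplex (q : R) : ShortComplex (ModuleCat.{u} R) :=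
  ModuleCat.shortComplexOfCompEqZero (LinearMap.lsmul R R q) (Ideal.span {q}).mkQ (by
    ext; simp)

lemma mulShortComplex_shortExact {q : R} (hq : ∀ a, q * a = 0 → a = 0) :
    (mulShortComplex q).ShortExact := by
  refine ModuleCat.shortComplex_shortExact _ ?_ ?_ ?_
  · intro y
    exact (Submodule.Quotient.mk_eq_zero _).trans
      (Ideal.mem_span_singleton.trans (exists_congr fun _ ↦ eq_comm))
  · exact (injective_iff_map_eq_zero _).mpr hq
  · exact Submodule.mkQ_surjective _

/-- The free resolution `R ⟶ R` bounds the projective dimension by 1. -/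
lemma ext_quotient_span_singleton_eq_zero {q : R} (hq : ∀ a, q * a = 0 → a = 0)
    {j : ℕ} (hj : 2 ≤ j) {Y : ModuleCat.{u} R}
    (e : Ext (ModuleCat.of R (R ⧸ Ideal.span {q})) Y j) : e = 0 := by
  have hP : Projective (ModuleCat.of R R) :=
    (IsProjective.iff_projective R).mp inferInstance
  have h : HasProjectiveDimensionLT (mulShortComplex q).X₃ 2 :=
    (mulShortComplex_shortExact hq).hasProjectiveDimensionLT_X₃ 1
      (projective_iff_hasProjectiveDimensionLT_one.mp hP)
      (hasProjectiveDimensionLT_of_ge _ 1 2 (by norm_num))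
  exact Ext.eq_zero_of_hasProjectiveDimensionLT e 2 hj

variable [IsLocalRing R]

/-- Any `s` outside `J` in the last power of `m` not contained in `J` works. -/
lemma exists_socle_element [IsNoetherianRing R] {J : Ideal R} (hJ : J ≠ ⊤)
    (hm : maximalIdeal R ≤ J.radical) :
    ∃ s, s ∉ J ∧ Submodule.colon J {s} = maximalIdeal R := by
  classical
  have hex : ∃ k, maximalIdeal R ^ k ≤ J :=
    Ideal.exists_pow_le_of_le_radical_of_fg hm (IsNoetherian.noetherian _)
  obtain ⟨k, hk⟩ : ∃ k, Nat.find hex = k + 1 := by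
    refine Nat.exists_eq_succ_of_ne_zero fun h ↦ hJ ?_
    have := Nat.find_spec hex
    rw [h] at this
    simpa using this
  have h1 := Nat.find_spec hex
  have h2 := Nat.find_min hex (m := k) (by omega)
  rw [hk] at h1
  obtain ⟨s, hs, hsJ⟩ := SetLike.not_le_iff_exists.mp h2
  refine ⟨s, hsJ, le_antisymm ?_ fun r hr ↦ ?_⟩
  · refine le_maximalIdeal fun h ↦ hsJ ?_
    have : (1 : R) ∈ Submodule.colon J {s} := h ▸ Submodule.mem_top
    simpa using this
  · rw [Submodule.mem_colon_singleton]
    exact h1 (by rw [pow_succ']; exact Ideal.mul_mem_mul hr hs)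

/-- Dévissage: a socle element `s` makes `R ⧸ J` an extension of `R ⧸ (J + sR)` by the residue
field. -/
lemma ext_quotient_eq_zero_of_residueField [IsNoetherianRing R] {Y : ModuleCat.{u} R} {j : ℕ}
    (h : ∀ e : Ext (ModuleCat.of R (R ⧸ maximalIdeal R)) Y j, e = 0) (J : Ideal R)
    (hm : maximalIdeal R ≤ J.radical) (e : Ext (ModuleCat.of R (R ⧸ J)) Y j) : e = 0 := by
  induction J using IsNoetherian.induction with
  | hgt J ih =>
  by_cases hJ : J = ⊤
  · subst hJ
    have : Limits.IsZero (ModuleCat.of R (R ⧸ (⊤ : Ideal R))) :=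
      ModuleCat.isZero_of_subsingleton _
    have := this.hasProjectiveDimensionLT_zero
    exact Ext.eq_zero_of_hasProjectiveDimensionLT e 0 (Nat.zero_le _)
  · obtain ⟨s, hs, hc⟩ := exists_socle_element hJ hm
    have hlt : J < J ⊔ Ideal.span {s} := by
      refine lt_of_le_of_ne le_sup_left fun he ↦ hs ?_
      rw [he]
      exact Submodule.mem_sup_right (Ideal.mem_span_singleton_self s)
    have h' : ∀ e : Ext (cyclicShortComplex J s).X₁ Y j, e = 0 := by
      change ∀ e : Ext (ModuleCat.of R (R ⧸ Submodule.colon J {s})) Y j, e = 0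
      rwa [hc]
    obtain ⟨x, rfl⟩ := Ext.contravariant_sequence_exact₂ (cyclicShortComplex_shortExact J s) Y e
      (h' _)
    rw [ih _ hlt (hm.trans (Ideal.radical_mono hlt.le)) x, Ext.comp_zero]

/-- If `R` has finite injective dimension and `q` is a regular element generating an ideal primary
to the maximal ideal, then `Ext^j(R ⧸ J, R)` vanishes for all `j ≥ 2` and all primary `J`. -/
lemma ext_quotient_self_eq_zero [IsNoetherianRing R] {q : R} (hq : ∀ a, q * a = 0 → a = 0)
    (hrad : (Ideal.span {q}).radical = maximalIdeal R) {n : ℕ}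
    [HasInjectiveDimensionLT (ModuleCat.of R R) n] {j : ℕ} (hj : 2 ≤ j) (J : Ideal R)
    (hm : maximalIdeal R ≤ J.radical)
    (e : Ext (ModuleCat.of R (R ⧸ J)) (ModuleCat.of R R) j) : e = 0 := by
  -- Descending induction on `j`, starting where the injective dimension bound applies.
  obtain ⟨d, hd⟩ : ∃ d, n ≤ j + d := ⟨n, by omega⟩
  induction d generalizing j J with
  | zero => exact Ext.eq_zero_of_hasInjectiveDimensionLT e n hd
  | succ d ih =>
    refine ext_quotient_eq_zero_of_residueField (fun e ↦ ?_) J hm e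
    have hne : Ideal.span {q} ≠ ⊤ := fun h ↦
      (maximalIdeal.isMaximal R).ne_top (by rw [← hrad, h, Ideal.radical_top])
    obtain ⟨s, hs, hc⟩ := exists_socle_element hne hrad.ge
    have h' : ∀ e : Ext (cyclicShortComplex (Ideal.span {q}) s).X₁ (ModuleCat.of R R) j,
        e = 0 := by
      intro e
      -- The residue field embeds in `R ⧸ qR` via `s`, so its `Ext^j` sits between `Ext^j(R ⧸ qR, R)
      -- = 0` and an `Ext^(j+1)` killed by induction.
      obtain ⟨x, rfl⟩ := Ext.contravariant_sequence_exact₁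
        (cyclicShortComplex_shortExact (Ideal.span {q}) s) _ e (add_comm 1 j)
        (ih (by omega) _ (hrad.ge.trans (Ideal.radical_mono le_sup_left)) _ (by omega))
      have hx : x = 0 := ext_quotient_span_singleton_eq_zero hq hj x
      rw [hx, Ext.comp_zero]
    change ∀ e : Ext (ModuleCat.of R (R ⧸ Submodule.colon _ {s})) _ j, e = 0 at h'
    rw [hc] at h'
    exact h' e

/-- Homomorphisms into `R ⧸ qR` extend from `R ⧸ (I : x)` to `R ⧸ I`. -/
lemma exists_factorization_cyclic [IsNoetherianRing R] {q : R} (hq : ∀ a, q * a = 0 → a = 0)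
    (hrad : (Ideal.span {q}).radical = maximalIdeal R) {n : ℕ}
    [HasInjectiveDimensionLT (ModuleCat.of R R) n] {I : Ideal R} (hI : Ideal.span {q} ≤ I) (x : R)
    (φ : (cyclicShortComplex I x).X₁ ⟶ (mulShortComplex q).X₃) :
    ∃ ψ : (cyclicShortComplex I x).X₂ ⟶ (mulShortComplex q).X₃,
      (cyclicShortComplex I x).f ≫ ψ = φ := by
  have hS := cyclicShortComplex_shortExact I x
  have hT := mulShortComplex_shortExact hq
  -- The connecting class of `φ` extends to `R ⧸ I`, the obstruction lying in `Ext^2`.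
  obtain ⟨e, he⟩ := Ext.contravariant_sequence_exact₁ hS (mulShortComplex q).X₁
    ((Ext.mk₀ φ).comp hT.extClass (zero_add 1)) (add_comm 1 1)
    (ext_quotient_self_eq_zero (n := n) hq hrad le_rfl (I ⊔ Ideal.span {x})
      (hrad.ge.trans (Ideal.radical_mono (hI.trans le_sup_left))) _)
  have hann : q • 𝟙 (cyclicShortComplex I x).X₂ = 0 := by
    refine ModuleCat.hom_ext (LinearMap.ext fun y ↦ ?_)
    obtain ⟨y, rfl⟩ := Submodule.mkQ_surjective _ y
    exact (Submodule.Quotient.mk_eq_zero I).mpr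
      (Ideal.mul_mem_right _ _ (hI (Ideal.mem_span_singleton_self q)))
  have hqe : e.comp (Ext.mk₀ (mulShortComplex q).f) (add_zero 1) = 0 := by
    have h1 : (mulShortComplex q).f = q • 𝟙 (mulShortComplex q).X₁ := rfl
    rw [h1, ← Ext.smul_eq_comp_mk₀]
    have h2 : q • e = (Ext.mk₀ (q • 𝟙 (cyclicShortComplex I x).X₂)).comp e (zero_add 1) := by
      simp [Ext.mk₀_smul]
    rw [h2, hann, Ext.mk₀_zero, Ext.zero_comp]
  -- Since `q` kills `e`, the class `e` comes from a map `ψ` into `R ⧸ qR`.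
  obtain ⟨y, hy⟩ := Ext.covariant_sequence_exact₁ _ hT e hqe (zero_add 1)
  obtain ⟨ψ, rfl⟩ := Ext.addEquiv₀.symm.surjective y
  refine ⟨ψ, ?_⟩
  have h0 : (Ext.mk₀ ((cyclicShortComplex I x).f ≫ ψ - φ)).comp hT.extClass (zero_add 1) = 0 := by
    rw [sub_eq_add_neg, Ext.mk₀_add, Ext.mk₀_neg, Ext.add_comp, Ext.neg_comp, ← he, ← hy]
    rw [← Ext.mk₀_comp_mk₀_assoc]
    exact add_neg_cancel _
  obtain ⟨z, hz⟩ := Ext.covariant_sequence_exact₃ _ hT _ (zero_add 1) h0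
  obtain ⟨g, rfl⟩ := Ext.addEquiv₀.symm.surjective z
  -- The error `f ≫ ψ - φ` lifts to a map into `R`, where `q` is regular although it kills the
  -- source.
  have hg : g = 0 := by
    refine ModuleCat.hom_ext (LinearMap.ext fun y ↦ ?_)
    obtain ⟨y, rfl⟩ := Submodule.mkQ_surjective _ y
    refine hq _ ?_
    rw [← smul_eq_mul, ← map_smul, ← map_smul]
    have h : (Submodule.colon I {x}).mkQ (q • y) = 0 :=
      (Submodule.Quotient.mk_eq_zero _).mpr (Submodule.mem_colon_singleton.mpr
        (Ideal.mul_mem_right _ _ (Ideal.mul_mem_right _ _ (hI (Ideal.mem_span_singleton_self q)))))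
    rw [h, map_zero]
  rw [hg, Ext.addEquiv₀_symm_apply, Ext.mk₀_zero, Ext.zero_comp, eq_comm, Ext.mk₀_eq_zero_iff] at hz
  exact sub_eq_zero.mp hz

end Ext

/-! ### Duality for ideals containing `Q` -/

section DoubleColon

variable {R : Type u} [CommRing R] [IsLocalRing R]

lemma colon_colon_eq [IsNoetherianRing R] {q : R} (hq : ∀ a, q * a = 0 → a = 0)
    (hrad : (Ideal.span {q}).radical = maximalIdeal R) (hGor : IsGorensteinLocal R)
    {I : Ideal R} (hI : Ideal.span {q} ≤ I) :
    Submodule.colon (Ideal.span {q}) (Submodule.colon (Ideal.span {q}) (I : Set R) : Set R) =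
      I := by
  obtain ⟨n, hn⟩ := hGor
  refine le_antisymm (fun x hx ↦ ?_) fun x hx ↦ ?_
  · by_contra hxI
    have hne : Ideal.span {q} ≠ ⊤ := fun h ↦
      (maximalIdeal.isMaximal R).ne_top (by rw [← hrad, h, Ideal.radical_top])
    obtain ⟨s, hs, hc⟩ := exists_socle_element hne hrad.ge
    have hK : Submodule.colon I {x} ≤ maximalIdeal R := by
      refine le_maximalIdeal fun h ↦ hxI ?_
      have : (1 : R) ∈ Submodule.colon I {x} := h ▸ Submodule.mem_top
      simpa using this
    -- If `x ∉ I`, then `x ↦ s` is well defined on the submodule generated by `x` and extends to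
    -- `ψ`. With `r = ψ(1)`, `r ∈ Q : I` but `x r ≡ s ≢ 0` modulo `Q`.
    obtain ⟨ψ, hψ⟩ := exists_factorization_cyclic (n := n + 1) hq hrad hI x
      (ModuleCat.ofHom (Submodule.mapQ (Submodule.colon I {x}) (Ideal.span {q})
        (LinearMap.mulRight R s) fun r hr ↦ by
          have h := hK hr
          rw [← hc, Submodule.mem_colon_singleton] at h
          exact h))
    obtain ⟨r, hr⟩ := (Ideal.span {q}).mkQ_surjective (ψ.hom (I.mkQ 1))
    have hmul (a : R) : ψ.hom (I.mkQ a) = (Ideal.span {q}).mkQ (a * r) := by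
      rw [← mul_one a, ← smul_eq_mul, map_smul, map_smul, ← hr, ← map_smul, smul_eq_mul,
        smul_eq_mul, mul_one]
    have hrI : r ∈ Submodule.colon (Ideal.span {q}) (I : Set R) := by
      refine Submodule.mem_colon.mpr fun a ha ↦ ?_
      have h := hmul a
      rw [show I.mkQ a = 0 from (Submodule.Quotient.mk_eq_zero I).mpr ha, map_zero] at h
      rw [smul_eq_mul, mul_comm]
      exact (Submodule.Quotient.mk_eq_zero _).mp h.symm
    have hxr : x * r ∈ Ideal.span {q} := Submodule.mem_colon.mp hx r hrI
    have h1 : ψ.hom (I.mkQ (1 * x)) = (Ideal.span {q}).mkQ (1 * s) :=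
      congrArg (fun f ↦ f.hom ((Submodule.colon I {x}).mkQ 1)) hψ
    rw [hmul, one_mul, one_mul] at h1
    refine hs ((Submodule.Quotient.mk_eq_zero _).mp (h1.symm.trans ?_))
    exact (Submodule.Quotient.mk_eq_zero _).mpr hxr
  · refine Submodule.mem_colon.mpr fun r hr ↦ ?_
    rw [smul_eq_mul, mul_comm]
    exact Submodule.mem_colon.mp hr x hx

end DoubleColon

/-! ### Regularity of the parameter -/

section Regular

variable {R : Type u} [CommRing R] [IsLocalRing R]

/-- In a reduced local ring of positive dimension, a generator of an ideal primary to the maximal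
ideal is regular. -/
lemma eq_zero_of_mul_eq_zero_of_radical_eq_maximalIdeal [IsReduced R]
    (hdim : ringKrullDim R = 1) {q : R}
    (hrad : (Ideal.span {q}).radical = maximalIdeal R) (a : R) (h : q * a = 0) : a = 0 := by
  have hprime (p : Ideal R) (hp : p.IsPrime) (hpm : p ≠ maximalIdeal R) : a ∈ p := by
    refine (hp.mem_or_mem (h ▸ p.zero_mem : q * a ∈ p)).resolve_left fun hqp ↦ hpm ?_
    refine le_antisymm (le_maximalIdeal hp.ne_top) ?_
    rw [← hrad, hp.radical_le_iff, Ideal.span_singleton_le_iff_mem]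
    exact hqp
  -- A nonmaximal prime exists by dimension 1; it puts `a` in `m` too, hence in every prime.
  obtain ⟨p, hp, hpm⟩ : ∃ p : Ideal R, p.IsPrime ∧ p ≠ maximalIdeal R := by
    by_contra! hall
    have : Ring.KrullDimLE 0 R := Ring.KrullDimLE.mk₀ fun I hI ↦
      hall I hI ▸ maximalIdeal.isMaximal R
    rw [ringKrullDimZero_iff_ringKrullDim_eq_zero.mp this] at hdim
    exact zero_ne_one hdim
  have hnil : a ∈ nilradical R := by
    rw [nilradical_eq_sInf, Ideal.mem_sInf]
    intro P hP
    by_cases hPm : P = maximalIdeal R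
    · exact hPm ▸ le_maximalIdeal hp.ne_top (hprime p hp hpm)
    · exact hprime P hP hPm
  rwa [nilradical_eq_zero] at hnil

end Regular

/-! ### Integral closure of `qR` and the conductor -/

section Integral

variable {R : Type u} [CommRing R]

/-- If `q` is a regular element, then `x` is integral over `qR` if and only if `x / q` is integral
over `R`. -/
lemma isIntegralOverIdeal_span_singleton_iff [Nontrivial R] {q : R} (hq : ∀ a, q * a = 0 → a = 0)
    (x : R) :
    IsIntegralOverIdeal (Ideal.span {q}) x ↔
      ∃ y ∈ normalization R, algebraMap R (FractionRing R) x = algebraMap R _ q * y := by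
  have hqr : q ∈ nonZeroDivisors R := mem_nonZeroDivisors_iff.mpr
    ⟨hq, fun a h ↦ hq a (by rwa [mul_comm])⟩
  have hu : IsUnit (algebraMap R (FractionRing R) q) :=
    IsLocalization.map_units (FractionRing R) ⟨q, hqr⟩
  have hinj : Function.Injective (algebraMap R (FractionRing R)) :=
    IsFractionRing.injective R (FractionRing R)
  constructor
  · rintro ⟨n, hn, a, ha, hsum⟩
    obtain ⟨y, hy⟩ : ∃ y, algebraMap R (FractionRing R) x = algebraMap R _ q * y :=
      ⟨↑hu.unit⁻¹ * algebraMap R _ x, by rw [← mul_assoc, hu.mul_val_inv, one_mul]⟩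
    refine ⟨y, ?_, hy⟩
    have hb (i : ℕ) : ∃ b, i ∈ Finset.Icc 1 n → a i = q ^ i * b := by
      by_cases hi : i ∈ Finset.Icc 1 n
      · have h := ha i hi
        rw [Ideal.span_singleton_pow, Ideal.mem_span_singleton] at h
        exact h.imp fun _ h _ ↦ h
      · exact ⟨0, fun h ↦ absurd h hi⟩
    choose b hb using hb
    -- The integral equation of `x` divided by `q ^ n`.
    refine ⟨.X ^ n + ∑ i ∈ Finset.Icc 1 n, .C (b i) * .X ^ (n - i), ?_, ?_⟩
    · refine Polynomial.monic_X_pow_add (lt_of_le_of_lt (Polynomial.degree_sum_le _ _) ?_)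
      refine (Finset.sup_lt_iff (WithBot.bot_lt_coe n)).mpr fun i hi ↦ ?_
      refine (Polynomial.degree_C_mul_X_pow_le _ _).trans_lt ?_
      have := Finset.mem_Icc.mp hi
      exact Nat.cast_lt.mpr (by omega : n - i < n)
    · have h := congrArg (algebraMap R (FractionRing R)) hsum
      refine (hu.pow n).mul_left_cancel ?_
      rw [mul_zero]
      simp only [map_add, map_pow, map_sum, map_mul, map_zero, hy] at h
      simp only [Polynomial.eval₂_add, Polynomial.eval₂_pow, Polynomial.eval₂_X,
        Polynomial.eval₂_finsetSum, Polynomial.eval₂_mul, Polynomial.eval₂_C]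
      rw [← h, mul_add, mul_pow, Finset.mul_sum]
      congr 1
      refine Finset.sum_congr rfl fun i hi ↦ ?_
      rw [hb i hi, map_mul, map_pow, mul_pow, ← pow_mul_pow_sub _ (Finset.mem_Icc.mp hi).2]
      ring
  · rintro ⟨y, ⟨p, hp, hpy⟩, hy⟩
    have hdeg : p.natDegree ≠ 0 := by
      intro h
      rw [hp.natDegree_eq_zero.mp h] at hpy
      simp at hpy
    refine ⟨p.natDegree, Nat.one_le_iff_ne_zero.mpr hdeg,
      fun i ↦ q ^ i * p.coeff (p.natDegree - i), fun i _ ↦ ?_, hinj ?_⟩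
    · rw [Ideal.span_singleton_pow]
      exact Ideal.mul_mem_right _ _ (Ideal.mem_span_singleton_self _)
    · rw [Polynomial.eval₂_eq_sum_range, Finset.sum_range_succ, hp.coeff_natDegree, map_one,
        one_mul] at hpy
      have h := congrArg (algebraMap R (FractionRing R) q ^ p.natDegree * ·) hpy
      simp only [map_add, map_pow, map_sum, map_mul, map_zero, hy]
      simp only [mul_zero] at h
      rw [← h, mul_add, add_comm, mul_pow, Finset.mul_sum]
      congr 1
      refine Finset.sum_bij' (fun i _ ↦ p.natDegree - i) (fun i _ ↦ p.natDegree - i)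
        (fun i hi ↦ ?_) (fun i hi ↦ ?_) (fun i hi ↦ ?_) (fun i hi ↦ ?_) (fun i hi ↦ ?_)
      any_goals simp only [Finset.mem_Icc, Finset.mem_range] at hi ⊢; omega
      have hi := (Finset.mem_Icc.mp hi).2
      rw [← pow_mul_pow_sub _ hi, mul_pow]
      ring

/-- The colon of `qR` by its integral closure is the conductor. -/
lemma mem_conductor_iff [Nontrivial R] {q : R} (hq : ∀ a, q * a = 0 → a = 0)
    (hqC : Ideal.span {q} ≤ conductor R) (r : R) :
    r ∈ conductor R ↔
      ∀ x, IsIntegralOverIdeal (Ideal.span {q}) x → r * x ∈ Ideal.span {q} := by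
  have hqr : q ∈ nonZeroDivisors R := mem_nonZeroDivisors_iff.mpr
    ⟨hq, fun a h ↦ hq a (by rwa [mul_comm])⟩
  have hu : IsUnit (algebraMap R (FractionRing R) q) :=
    IsLocalization.map_units (FractionRing R) ⟨q, hqr⟩
  have hinj : Function.Injective (algebraMap R (FractionRing R)) :=
    IsFractionRing.injective R (FractionRing R)
  have hmem (t : R) : t ∈ conductor R ↔
      ∀ y ∈ normalization R, ∃ z, algebraMap R (FractionRing R) z = algebraMap R _ t * y := by
    simp [conductor, Submodule.mem_colon, Submodule.mem_one, Algebra.smul_def]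
  rw [hmem]
  constructor
  · intro h x hx
    obtain ⟨y, hy, hxy⟩ := (isIntegralOverIdeal_span_singleton_iff hq x).mp hx
    obtain ⟨z, hz⟩ := h y hy
    refine Ideal.mem_span_singleton.mpr ⟨z, hinj ?_⟩
    rw [map_mul, map_mul, hxy, hz]
    ring
  · intro h y hy
    -- Here `Q ⊆ C` enters: `q y` comes from `R`.
    obtain ⟨x, hx⟩ := (hmem q).mp (hqC (Ideal.mem_span_singleton_self q)) y hy
    obtain ⟨z, hz⟩ := Ideal.mem_span_singleton.mp
      (h x ((isIntegralOverIdeal_span_singleton_iff hq x).mpr ⟨y, hy, hx⟩))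
    refine ⟨z, hu.mul_left_cancel ?_⟩
    rw [← map_mul, ← hz, map_mul, hx]
    ring

/-- The integral closure of the ideal generated by a regular element. -/
noncomputable def integralClosureSpanSingleton [Nontrivial R] {q : R}
    (hq : ∀ a, q * a = 0 → a = 0) : Ideal R where
  carrier := {x | IsIntegralOverIdeal (Ideal.span {q}) x}
  add_mem' {x x'} hx hx' := by
    obtain ⟨y, hy, h⟩ := (isIntegralOverIdeal_span_singleton_iff hq x).mp hx
    obtain ⟨y', hy', h'⟩ := (isIntegralOverIdeal_span_singleton_iff hq x').mp hx'
    exact (isIntegralOverIdeal_span_singleton_iff hq _).mpr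
      ⟨y + y', add_mem hy hy', by rw [map_add, h, h', mul_add]⟩
  zero_mem' := (isIntegralOverIdeal_span_singleton_iff hq 0).mpr
    ⟨0, zero_mem _, by rw [map_zero, mul_zero]⟩
  smul_mem' r x hx := by
    obtain ⟨y, hy, h⟩ := (isIntegralOverIdeal_span_singleton_iff hq x).mp hx
    exact (isIntegralOverIdeal_span_singleton_iff hq _).mpr
      ⟨r • y, Subalgebra.smul_mem _ hy r, by
        rw [smul_eq_mul, map_mul, h, Algebra.smul_def, mul_left_comm]⟩

lemma mem_integralClosureSpanSingleton [Nontrivial R] {q : R} {hq : ∀ a, q * a = 0 → a = 0}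
    {x : R} : x ∈ integralClosureSpanSingleton hq ↔ IsIntegralOverIdeal (Ideal.span {q}) x :=
  Iff.rfl

lemma span_le_integralClosureSpanSingleton [Nontrivial R] {q : R}
    (hq : ∀ a, q * a = 0 → a = 0) : Ideal.span {q} ≤ integralClosureSpanSingleton hq := by
  rw [Ideal.span_singleton_le_iff_mem, mem_integralClosureSpanSingleton,
    isIntegralOverIdeal_span_singleton_iff hq]
  exact ⟨1, one_mem _, (mul_one _).symm⟩

lemma colon_integralClosureSpanSingleton [Nontrivial R] {q : R} (hq : ∀ a, q * a = 0 → a = 0)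
    (hqC : Ideal.span {q} ≤ conductor R) :
    Submodule.colon (Ideal.span {q}) (integralClosureSpanSingleton hq : Set R) = conductor R := by
  ext r
  rw [mem_conductor_iff hq hqC, Submodule.mem_colon]
  rfl

lemma not_isIntegralOverIdeal_one {J : Ideal R} (hJ : J ≠ ⊤) : ¬ IsIntegralOverIdeal J 1 := by
  rintro ⟨n, -, a, ha, hsum⟩
  refine hJ ((Ideal.eq_top_iff_one J).mpr ?_)
  rw [one_pow] at hsum
  rw [eq_neg_of_add_eq_zero_left hsum]
  refine neg_mem (sum_mem fun i hi ↦ Ideal.mul_mem_right _ _ ?_)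
  exact Ideal.pow_le_self (Nat.one_le_iff_ne_zero.mp (Finset.mem_Icc.mp hi).1) (ha i hi)

end Integral

/-! ### Comparison of the exponent sets -/

section Exponents

variable {R : Type u} [CommRing R] [IsLocalRing R]

lemma mem_integralColonExponents_iff [IsNoetherianRing R] {q : R}
    (hq : ∀ a, q * a = 0 → a = 0) (hrad : (Ideal.span {q}).radical = maximalIdeal R)
    (hGor : IsGorensteinLocal R) (hqC : Ideal.span {q} ≤ conductor R) (i : ℕ) :
    i ∈ integralColonExponents (Ideal.span {q}) ↔
      conductor R ≤ maximalIdeal R ^ i ⊔ Ideal.span {q} := by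
  have hC := colon_integralClosureSpanSingleton hq hqC
  have hCC := colon_colon_eq hq hrad hGor (span_le_integralClosureSpanSingleton hq)
  rw [hC] at hCC
  have hsup : Submodule.colon (Ideal.span {q})
      ((maximalIdeal R ^ i ⊔ Ideal.span {q} : Ideal R) : Set R) =
        Submodule.colon (Ideal.span {q}) ((maximalIdeal R ^ i : Ideal R) : Set R) := by
    refine le_antisymm (Submodule.colon_mono le_rfl (SetLike.coe_subset_coe.mpr le_sup_left))
      fun r hr ↦ Submodule.mem_colon.mpr fun s hs ↦ ?_
    obtain ⟨a, ha, b, hb, rfl⟩ := Submodule.mem_sup.mp hs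
    rw [smul_add]
    exact add_mem (Submodule.mem_colon.mp hr a ha) (Submodule.smul_mem _ r hb)
  change Submodule.colon _ _ ≤ integralClosureSpanSingleton hq ↔ _
  rw [← hsup, ← hCC]
  refine ⟨fun h ↦ ?_, fun h ↦ Submodule.colon_mono le_rfl (SetLike.coe_subset_coe.mpr h)⟩
  -- Applying `Q : _` once more recovers both ideals, as each contains `Q`.
  rw [← colon_colon_eq hq hrad hGor hqC, ← colon_colon_eq hq hrad hGor
    (le_sup_right : Ideal.span {q} ≤ maximalIdeal R ^ i ⊔ Ideal.span {q})]
  exact Submodule.colon_mono le_rfl (SetLike.coe_subset_coe.mpr h)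

lemma isGreatest_gotoNumber [IsNoetherianRing R] {Q : Ideal R}
    (hrad : Q.radical = maximalIdeal R) (h0 : 0 ∈ integralColonExponents Q) :
    IsGreatest (integralColonExponents Q) (gotoNumber Q) := by
  have hne : Q ≠ ⊤ := fun h ↦
    (maximalIdeal.isMaximal R).ne_top (by rw [← hrad, h, Ideal.radical_top])
  obtain ⟨k, hk⟩ := Ideal.exists_pow_le_of_le_radical_of_fg hrad.ge (IsNoetherian.noetherian _)
  -- Once `m ^ i ⊆ Q`, the colon contains `1`, which is not integral over a proper ideal.
  have hbdd : BddAbove (integralColonExponents Q) := by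
    refine ⟨k, fun i hi ↦ le_of_not_gt fun hki ↦ not_isIntegralOverIdeal_one hne (hi 1 ?_)⟩
    refine Submodule.mem_colon.mpr fun s hs ↦ ?_
    rw [one_smul]
    exact hk (Ideal.pow_le_pow_right hki.le hs)
  exact ⟨Nat.sSup_mem ⟨0, h0⟩ hbdd, fun i hi ↦ le_csSup hbdd hi⟩

end Exponents

end GotoNumber

theorem proposition3p8 (R : Type u) [CommRing R] [IsLocalRing R] [IsNoetherianRing R]
    [IsReduced R] (hdim : ringKrullDim R = 1) (hGor : GotoNumber.IsGorensteinLocal R)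
    (hfin : Module.Finite R (GotoNumber.normalization R))
    (q : R) (hq : GotoNumber.IsParameterIdeal (Ideal.span {q}))
    (hqC : Ideal.span {q} ≤ GotoNumber.conductor R) :
    IsGreatest (GotoNumber.integralColonExponents (Ideal.span {q}))
        (GotoNumber.gotoNumber (Ideal.span {q})) ∧
      IsGreatest
        {i : ℕ | GotoNumber.conductor R ≤ IsLocalRing.maximalIdeal R ^ i ⊔ Ideal.span {q}}
        (GotoNumber.gotoNumber (Ideal.span {q})) := by
  have hreg := GotoNumber.eq_zero_of_mul_eq_zero_of_radical_eq_maximalIdeal hdim hq.1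
  have hmem := GotoNumber.mem_integralColonExponents_iff hreg hq.1 hGor hqC
  have hset : {i : ℕ | GotoNumber.conductor R ≤ IsLocalRing.maximalIdeal R ^ i ⊔ Ideal.span {q}} =
      GotoNumber.integralColonExponents (Ideal.span {q}) := Set.ext fun i ↦ (hmem i).symm
  rw [hset, and_self_iff]
  refine GotoNumber.isGreatest_gotoNumber hq.1 ((hmem 0).mpr ?_)
  rw [pow_zero, Ideal.one_eq_top, top_sup_eq]
  exact le_top
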